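/- Let $\mathbb R_+=(0,\infty)$, let $(\cdot,\cdot)$ and $\|\cdot\|$ be the inner product and norm of $L^2(\mathbb R_+)$ (real-valued functions), and $\|v\|_1=(\|v\|^2+\|v'\|^2)^{1/2}$ the norm of $H^1(\mathbb R_+)$. Let $H_0^1(\mathbb R_+)$ be the closure of $C_c^\infty(\mathbb R_+)$ in $H^1(\mathbb R_+)$. For $\beta>0$ and an integer $N\ge 0$ let $P_N$ be the real polynomials of degree at most $N$, $$\widehat P_N^{\beta}=\{e^{-\beta x/2}\psi(x):\psi\in P_N\},\qquad \widehat P_{N,\beta}^0=\{\phi\in\widehat P_N^\beta:\phi(0)=0\},$$ and let $\widehat\Pi_N^\beta:L^2(\mathbb R_+)\to\widehat P_N^\beta$ be the $L^2(\mathbb R_+)$-orthogonal projection. For $f$ continuous on $[0,\infty)$ let $\widehat I_N^\beta f\in\widehat P_N^\beta$ be the function that agrees with $f$ at the $N+1$ Laguerre--Gauss nodes, i.e. the zeros of $\mathscr L_{N+1}^{(0)}(\beta x)$, or, as a second choice, at the $N+1$ Laguerre--Gauss--Radau nodes, i.e. the zeros of $x\,\mathscr L_N^{(1)}(\beta x)$,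 where $\mathscr L_n^{(\alpha)}$ is the generalized Laguerre polynomial of degree $n$. For $\gamma>0$ put $a(u,v)=(u',v')+\gamma(u,v)$. Then for every $\gamma>0$ there is a constant $C>0$, depending only on $\gamma$, such that the following holds for either choice of nodes, all $\beta>0$, all integers $N\ge1$ and all $f\in C[0,\infty)\cap L^2(\mathbb R_+)$. If $u\in H_0^1(\mathbb R_+)$ is the weak solution of $-u''+\gamma u=f$ on $\mathbb R_+$, $u(0)=0$, $\lim_{x\to\infty}u(x)=0$, that is, $$a(u,v)=(f,v)\quad\text{for all }v\in H_0^1(\mathbb R_+),$$ and $u_{N,\beta}\in\widehat P_{N,\beta}^0$ is the solution of the Laguerre--Galerkin problem $$a(u_{N,\beta},v)=(\widehat I_N^\beta f,v)\quad\text{for all }v\in\widehat P_{N,\beta}^0,$$ then $$\|u-u_{N,\beta}\|_1\le C\Big[\Big(\frac1\beta+1\Big)\|u'-\widehat\Pi_{N-1}^\beta u'\|+(1+\beta)\|u-\widehat\Pi_{N-1}^\beta u\|+\|f-\widehat I_N^\beta f\|\Big].$$ -/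

import Mathlib

open MeasureTheory Set Polynomial

namespace LaguerreGalerkin

noncomputable section

/-- Lebesgue measure on the half line `ℝ₊ = (0, ∞)`. -/
abbrev muPos : Measure ℝ := volume.restrict (Ioi 0)

/-- The real Hilbert space `L²(ℝ₊)`. -/
abbrev L2 : Type := Lp ℝ 2 muPos

/-- The Hilbert sum `L²(ℝ₊) × L²(ℝ₊)`. A function `u ∈ H¹(ℝ₊)` is represented by the pair
`(u, u')` of `u` and its weak derivative, so that the norm of the pair is the `H¹` norm
`‖u‖₁ = (‖u‖² + ‖u'‖²)^(1/2)`. -/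
abbrev L2Pair : Type := WithLp 2 (L2 × L2)

/-- `φ ∈ C_c^∞(ℝ₊)`: smooth, with compact support contained in the open half line. -/
def IsTest (φ : ℝ → ℝ) : Prop :=
  ContDiff ℝ (⊤ : ℕ∞) φ ∧ HasCompactSupport φ ∧ tsupport φ ⊆ Ioi 0

/-- `g` is the weak derivative of `u` on `ℝ₊`. -/
def IsWeakDeriv (u g : L2) : Prop :=
  ∀ φ : ℝ → ℝ, IsTest φ →
    ∫ x in Ioi (0 : ℝ), u x * deriv φ x = -∫ x in Ioi (0 : ℝ), g x * φ x

/-- The Sobolev space `H¹(ℝ₊)`, as the set of pairs `(u, u')`. -/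
def H1 : Set L2Pair := {U | IsWeakDeriv U.fst U.snd}

/-- The pairs `(φ, φ')` with `φ ∈ C_c^∞(ℝ₊)`. -/
def testPairs : Set L2Pair :=
  {U | ∃ φ : ℝ → ℝ, IsTest φ ∧ U.fst =ᵐ[muPos] φ ∧ U.snd =ᵐ[muPos] deriv φ}

/-- `H¹₀(ℝ₊)`: the closure of `C_c^∞(ℝ₊)` in `H¹(ℝ₊)` for the `H¹` norm. -/
def H10 : Set L2Pair := H1 ∩ closure testPairs

/-- The bilinear form `a(u, v) = (u', v') + γ (u, v)`. -/
def bilin (γ : ℝ) (U V : L2Pair) : ℝ := inner ℝ U.snd V.snd + γ * inner ℝ U.fst V.fst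

/-- `(u, u')` is a weak solution of `-u'' + γ u = f` on `ℝ₊`, `u(0) = 0`, `u(∞) = 0`. -/
def IsWeakSolution (γ : ℝ) (f : ℝ → ℝ) (U : L2Pair) : Prop :=
  U ∈ H10 ∧ ∀ V ∈ H10, bilin γ U V = ∫ x in Ioi (0 : ℝ), f x * V.fst x

/-- The function `x ↦ e^{-βx/2} p(x)`. -/
def expPoly (β : ℝ) (p : ℝ[X]) (x : ℝ) : ℝ := Real.exp (-(β * x / 2)) * p.eval x

theorem memLp_expPoly {β : ℝ} (hβ : 0 < β) (p : ℝ[X]) : MemLp (expPoly β p) 2 muPos := by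
  have hc : Continuous (expPoly β p) := by
    unfold expPoly
    fun_prop
  rw [memLp_two_iff_integrable_sq hc.aestronglyMeasurable]
  have key : ∀ q : ℝ[X], (fun x : ℝ => q.eval x) =O[Filter.atTop]
      fun x : ℝ => Real.exp (β / 2 * x) := by
    intro q
    induction q using Polynomial.induction_on' with
    | add q r hq hr => simpa [Polynomial.eval_add] using hq.add hr
    | monomial n a =>
      simpa [Polynomial.eval_monomial] using
        ((isLittleO_pow_exp_pos_mul_atTop n (half_pos hβ)).isBigO).const_mul_left a
  refine integrable_of_isBigO_exp_neg (half_pos hβ) (hc.pow 2).continuousOn ?_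
  have h1 := (Asymptotics.isBigO_refl (fun x : ℝ => Real.exp (-(β * x))) Filter.atTop).mul
    (key (p ^ 2))
  refine (h1.congr_left ?_).congr_right ?_
  · intro x
    have : Real.exp (-(β * x)) = Real.exp (-(β * x / 2)) ^ 2 := by
      rw [← Real.exp_nat_mul]; congr 1; push_cast; ring
    simp only [expPoly, this, eval_pow]; ring
  · intro x
    rw [← Real.exp_add]; congr 1; ring

/-- `p ↦ e^{-βx/2} p(x)` as a linear map into `L²(ℝ₊)`. -/
def expPolyL2 {β : ℝ} (hβ : 0 < β) : ℝ[X] →ₗ[ℝ] L2 where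
  toFun p := (memLp_expPoly hβ p).toLp (expPoly β p)
  map_add' p q := by
    rw [← MemLp.toLp_add]
    congr 1
    funext x
    simp [expPoly, mul_add]
  map_smul' c p := by
    rw [RingHom.id_apply, ← MemLp.toLp_const_smul]
    congr 1
    funext x
    simp [expPoly, mul_left_comm]

/-- The space `{e^{-βx/2} ψ : ψ ∈ P_N}` of scaled Laguerre functions of degree at most `N`,
as a subspace of `L²(ℝ₊)`. -/
def lagSpace {β : ℝ} (hβ : 0 < β) (N : ℕ) : Submodule ℝ L2 :=
  (degreeLE ℝ N).map (expPolyL2 hβ)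

instance {β : ℝ} (hβ : 0 < β) (N : ℕ) : FiniteDimensional ℝ (lagSpace hβ N) := by
  classical
  rw [lagSpace, degreeLE_eq_span_X_pow, Submodule.map_span]
  exact FiniteDimensional.span_of_finite ℝ ((Finset.finite_toSet _).image _)

/-- The orthogonal projection of `L²(ℝ₊)` onto the space of scaled Laguerre functions of degree
at most `N`. -/
def lagProj {β : ℝ} (hβ : 0 < β) (N : ℕ) : L2 →L[ℝ] L2 := (lagSpace hβ N).starProjection

/-- The discrete space `{φ = e^{-βx/2} ψ : ψ ∈ P_N, φ(0) = 0}`, as the set of pairs `(φ, φ')`. -/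
def galerkinSpace (β : ℝ) (N : ℕ) : Set L2Pair :=
  {U | ∃ p ∈ degreeLE ℝ N, expPoly β p 0 = 0 ∧
    U.fst =ᵐ[muPos] expPoly β p ∧ U.snd =ᵐ[muPos] deriv (expPoly β p)}

/-- The generalized Laguerre polynomial
`L_n^{(α)}(x) = ∑_{k ≤ n} (-1)^k binom(n + α, n - k) x^k / k!`. -/
def laguerre (α : ℝ) (n : ℕ) : ℝ[X] :=
  ∑ k ∈ Finset.range (n + 1),
    C ((-1) ^ k * Ring.choose ((n : ℝ) + α) (n - k) / (k.factorial : ℝ)) * X ^ k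

/-- The two families of interpolation nodes: Laguerre–Gauss and Laguerre–Gauss–Radau. -/
inductive Rule
  | gauss
  | radau

/-- The polynomial whose zeros are the `N + 1` interpolation nodes:
`L_{N+1}^{(0)}(βx)` (Gauss) or `x L_N^{(1)}(βx)` (Gauss–Radau). -/
def nodePoly (Z : Rule) (β : ℝ) (N : ℕ) : ℝ[X] :=
  match Z with
  | .gauss => (laguerre 0 (N + 1)).comp (C β * X)
  | .radau => X * (laguerre 1 N).comp (C β * X)

/-- The set of interpolation nodes. -/
def nodes (Z : Rule) (β : ℝ) (N : ℕ) : Finset ℝ := (nodePoly Z β N).roots.toFinset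

/-- The interpolant of `f` of the form `e^{-βx/2} ψ(x)`, `ψ ∈ P_N`, that agrees with `f`
at the nodes. -/
def interp (Z : Rule) (β : ℝ) (N : ℕ) (f : ℝ → ℝ) : ℝ → ℝ :=
  expPoly β (Lagrange.interpolate (nodes Z β N) id fun ξ => Real.exp (β * ξ / 2) * f ξ)

/-- `(u_N, u_N')` solves the Laguerre–Galerkin problem with interpolated right-hand side. -/
def IsGalerkinSolution (Z : Rule) (γ β : ℝ) (N : ℕ) (f : ℝ → ℝ) (UN : L2Pair) : Prop :=
  UN ∈ galerkinSpace β N ∧ ∀ V ∈ galerkinSpace β N,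
    bilin γ UN V = ∫ x in Ioi (0 : ℝ), interp Z β N f x * V.fst x

/-- The `L²(ℝ₊)` norm of a square integrable function. -/
def normL2 (g : ℝ → ℝ) : ℝ := (eLpNorm g 2 muPos).toReal

end

end LaguerreGalerkin

open LaguerreGalerkin

/-! The error splits through a discrete `W` that is close to `u`, as in Strang's lemma.

The choice of `W` rests on two facts about the operator `v ↦ v' + (β/2) v`. It sends `e^{-βx/2} P`
to `e^{-βx/2} P'`, so it maps the discrete space onto the scaled Laguerre functions of degree at
most `N - 1`; hence `W` can be chosen with image the projection of `u' + (β/2) u`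
(`exists_galerkin_primitive`). On `H¹₀` one has `(v, v') = 0`, so `‖v' + (β/2) v‖² = ‖v'‖² + (β²/4)
‖v‖²`, which controls the `H¹` norm (`norm_le_of_mem_closure`). Applied to `u - W`, this gives
`exists_galerkin_approx`.

Coercivity and boundedness of `a` then bound `u_N - W` by `u - W` and the interpolation error. The
nodes play no role: only square integrability of the interpolant matters. Both steps need the
discrete functions to lie in `H¹₀`, which is proved by cutting off. -/

open Filter Topology

namespace LaguerreGalerkin

/-! ### Limits and inner products in `L²`. -/

/-- Dominated convergence in `L²`. -/
theorem tendsto_toLp_of_dominated {α : Type*} [MeasurableSpace α] {μ : Measure α}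
    {F : ℕ → α → ℝ} {f g : α → ℝ}
    (hF : ∀ n, MemLp (F n) 2 μ) (hf : MemLp f 2 μ) (hg : MemLp g 2 μ)
    (hbound : ∀ n, ∀ᵐ x ∂μ, |F n x - f x| ≤ g x)
    (hlim : ∀ᵐ x ∂μ, Tendsto (fun n => F n x) atTop (𝓝 (f x))) :
    Tendsto (fun n => (hF n).toLp (F n)) atTop (𝓝 (hf.toLp f)) := by
  rw [tendsto_iff_norm_sub_tendsto_zero]
  have hsq : ∀ n, ‖(hF n).toLp (F n) - hf.toLp f‖ ^ 2 = ∫ x, (F n x - f x) ^ 2 ∂μ := by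
    intro n
    rw [← real_inner_self_eq_norm_sq, L2.inner_def]
    refine integral_congr_ae ?_
    filter_upwards [Lp.coeFn_sub ((hF n).toLp (F n)) (hf.toLp f), (hF n).coeFn_toLp,
      hf.coeFn_toLp] with x h1 h2 h3
    rw [h1, Pi.sub_apply, h2, h3, real_inner_self_eq_norm_sq, Real.norm_eq_abs, sq_abs]
  have hint : Tendsto (fun n => ∫ x, (F n x - f x) ^ 2 ∂μ) atTop (𝓝 (∫ _, (0 : ℝ) ∂μ)) := by
    refine tendsto_integral_of_dominated_convergence (fun x => g x ^ 2) ?_ hg.integrable_sq ?_ ?_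
    · intro n
      exact (((hF n).1.sub hf.1).pow 2)
    · intro n
      filter_upwards [hbound n] with x hx
      rw [Real.norm_eq_abs, abs_pow]
      exact pow_le_pow_left₀ (abs_nonneg _) hx 2
    · filter_upwards [hlim] with x hx
      simpa using (hx.sub_const (f x)).pow 2
  simp_rw [← hsq] at hint
  have := hint.sqrt
  simpa [Real.sqrt_sq (norm_nonneg _)] using this

theorem inner_eq_setIntegral {u v : L2} {f g : ℝ → ℝ} (hu : u =ᵐ[muPos] f)
    (hv : v =ᵐ[muPos] g) : inner ℝ u v = ∫ x in Ioi (0 : ℝ), f x * g x := by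
  rw [L2.inner_def]
  refine integral_congr_ae ?_
  filter_upwards [hu, hv] with x h1 h2
  simp [h1, h2, mul_comm]

/-! ### Test functions and their closure. -/

namespace IsTest

variable {φ ψ : ℝ → ℝ}

theorem differentiable (h : IsTest φ) : Differentiable ℝ φ := h.1.differentiable (by simp)

theorem eq_zero (h : IsTest φ) : φ 0 = 0 :=
  image_eq_zero_of_notMem_tsupport fun h0 => lt_irrefl (0 : ℝ) (h.2.2 h0)

theorem add (h : IsTest φ) (h' : IsTest ψ) : IsTest (φ + ψ) :=
  ⟨h.1.add h'.1, h.2.1.add h'.2.1, (tsupport_add _ _).trans (union_subset h.2.2 h'.2.2)⟩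

theorem const_smul (c : ℝ) (h : IsTest φ) : IsTest (c • φ) :=
  ⟨h.1.const_smul c, h.2.1.mono (Function.support_const_smul_subset c φ),
    (closure_mono (Function.support_const_smul_subset c φ)).trans h.2.2⟩

theorem zero : IsTest 0 := ⟨contDiff_const, HasCompactSupport.zero, by simp⟩

theorem memLp (h : IsTest φ) : MemLp φ 2 muPos :=
  (h.1.continuous.memLp_of_hasCompactSupport h.2.1).restrict _

theorem memLp_deriv (h : IsTest φ) : MemLp (deriv φ) 2 muPos :=
  ((h.1.continuous_deriv (by simp)).memLp_of_hasCompactSupport h.2.1.deriv).restrict _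

/-- Integration by parts against a test function. -/
theorem integral_mul_deriv (h : IsTest φ) {w : ℝ → ℝ} (hw : ContDiff ℝ 1 w) :
    ∫ x in Ioi (0 : ℝ), w x * deriv φ x = -∫ x in Ioi (0 : ℝ), deriv w x * φ x := by
  have hφ1 : ContDiff ℝ 1 φ := h.1.of_le (by exact_mod_cast le_top)
  have hd := HasCompactSupport.integral_Ioi_deriv_eq (hw.mul hφ1) (h.2.1.mul_left) 0
  have hder : deriv (fun x => w x * φ x) = fun x => deriv w x * φ x + w x * deriv φ x := by
    funext x
    exact deriv_mul (hw.differentiable (by simp) x) (h.differentiable x)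
  rw [hder, h.eq_zero] at hd
  have i1 : Integrable (fun x => deriv w x * φ x) :=
    ((hw.continuous_deriv (by simp)).mul h.1.continuous).integrable_of_hasCompactSupport
      h.2.1.mul_left
  have i2 : Integrable (fun x => w x * deriv φ x) :=
    (hw.continuous.mul (h.1.continuous_deriv (by simp))).integrable_of_hasCompactSupport
      h.2.1.deriv.mul_left
  rw [integral_add i1.integrableOn i2.integrableOn] at hd
  linarith

end IsTest

/-- The pairs `(φ, φ')` with `φ` a test function, as a subspace. -/
def testSubmodule : Submodule ℝ L2Pair where
  carrier := testPairs
  zero_mem' := ⟨0, IsTest.zero, Lp.coeFn_zero _ _ _, by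
    have : deriv (0 : ℝ → ℝ) = 0 := by funext x; simp
    rw [this]; exact Lp.coeFn_zero _ _ _⟩
  add_mem' := by
    rintro U V ⟨φ, hφ, h1, h2⟩ ⟨ψ, hψ, h3, h4⟩
    refine ⟨φ + ψ, hφ.add hψ, (Lp.coeFn_add _ _).trans (h1.add h3), ?_⟩
    have : deriv (φ + ψ) = deriv φ + deriv ψ := by
      funext x; exact deriv_add (hφ.differentiable x) (hψ.differentiable x)
    rw [this]
    exact (Lp.coeFn_add _ _).trans (h2.add h4)
  smul_mem' := by
    rintro c U ⟨φ, hφ, h1, h2⟩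
    refine ⟨c • φ, hφ.const_smul c, (Lp.coeFn_smul _ _).trans (h1.const_smul c), ?_⟩
    have : deriv (c • φ) = c • deriv φ := by
      funext x; exact deriv_const_smul c (hφ.differentiable x)
    rw [this]
    exact (Lp.coeFn_smul _ _).trans (h2.const_smul c)

/-- A function of `H¹₀(ℝ₊)` is `L²`-orthogonal to its derivative. -/
theorem inner_fst_snd_eq_zero {U : L2Pair} (hU : U ∈ testSubmodule.topologicalClosure) :
    inner ℝ U.fst U.snd = 0 := by
  have hclosed : IsClosed {V : L2Pair | inner ℝ V.fst V.snd = (0 : ℝ)} :=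
    isClosed_eq (by fun_prop) continuous_const
  refine closure_minimal ?_ hclosed hU
  rintro V ⟨φ, hφ, h1, h2⟩
  -- With `w = φ`, integration by parts says that `∫ φ φ'` equals its own negative.
  have h := hφ.integral_mul_deriv (hφ.1.of_le (by exact_mod_cast le_top))
  have hc : ∫ x in Ioi (0 : ℝ), deriv φ x * φ x = ∫ x in Ioi (0 : ℝ), φ x * deriv φ x := by
    simp_rw [mul_comm]
  rw [hc] at h
  show inner ℝ V.fst V.snd = (0 : ℝ)
  rw [inner_eq_setIntegral h1 h2]
  linarith

theorem contDiff_expPoly {n : WithTop ℕ∞} (β : ℝ) (p : ℝ[X]) : ContDiff ℝ n (expPoly β p) := by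
  unfold expPoly
  exact (Real.contDiff_exp.comp (by fun_prop)).mul (by simpa using p.contDiff_aeval (𝕜 := ℝ) n)

theorem hasDerivAt_expPoly (β : ℝ) (p : ℝ[X]) (x : ℝ) :
    HasDerivAt (expPoly β p) (expPoly β (derivative p - C (β / 2) * p) x) x := by
  have h1 : HasDerivAt (fun x : ℝ => -(β * x / 2)) (-(β * 1 / 2)) x :=
    (((hasDerivAt_id x).const_mul β).div_const 2).neg
  refine (h1.exp.mul (p.hasDerivAt x)).congr_deriv ?_
  simp only [expPoly, eval_sub, eval_mul, eval_C]
  ring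

theorem deriv_expPoly (β : ℝ) (p : ℝ[X]) :
    deriv (expPoly β p) = expPoly β (derivative p - C (β / 2) * p) :=
  funext fun x => (hasDerivAt_expPoly β p x).deriv

/-! ### Cutoff functions. -/

/-- A smooth step: `0` on `(-∞, 1]` and `1` on `[2, ∞)`. -/
noncomputable def step (t : ℝ) : ℝ := Real.smoothTransition (t - 1)

theorem contDiff_step : ContDiff ℝ (⊤ : ℕ∞) step :=
  Real.smoothTransition.contDiff.comp (contDiff_id.sub contDiff_const)

theorem step_of_le {t : ℝ} (h : t ≤ 1) : step t = 0 :=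
  Real.smoothTransition.zero_of_nonpos (by linarith)

theorem step_of_ge {t : ℝ} (h : 2 ≤ t) : step t = 1 :=
  Real.smoothTransition.one_of_one_le (by linarith)

theorem step_nonneg (t : ℝ) : 0 ≤ step t := Real.smoothTransition.nonneg _

theorem step_le_one (t : ℝ) : step t ≤ 1 := Real.smoothTransition.le_one _

theorem deriv_step_of_lt {t : ℝ} (h : t < 1) : deriv step t = 0 := by
  have : step =ᶠ[𝓝 t] fun _ => 0 := by
    filter_upwards [Iio_mem_nhds h] with s hs using step_of_le (le_of_lt hs)
  simpa using this.deriv_eq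

theorem deriv_step_of_gt {t : ℝ} (h : 2 < t) : deriv step t = 0 := by
  have : step =ᶠ[𝓝 t] fun _ => 1 := by
    filter_upwards [Ioi_mem_nhds h] with s hs using step_of_ge (le_of_lt hs)
  simpa using this.deriv_eq

/-- The quantity `t * step' t` is invariant under rescaling `t`, so this single bound serves every
cutoff, uniformly in `n`, although the derivative of the cutoff near `0` grows like `n`. -/
theorem exists_abs_mul_deriv_step_le : ∃ M : ℝ, ∀ t : ℝ, |t * deriv step t| ≤ M := by
  have hc : Continuous fun t : ℝ => t * deriv step t :=
    continuous_id.mul (contDiff_step.continuous_deriv (by simp))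
  have hs : HasCompactSupport fun t : ℝ => t * deriv step t := by
    refine HasCompactSupport.intro (isCompact_Icc (a := (1 : ℝ)) (b := 2)) fun t ht => ?_
    rcases not_and_or.1 ht with h | h
    · rw [deriv_step_of_lt (not_le.1 h), mul_zero]
    · rw [deriv_step_of_gt (not_le.1 h), mul_zero]
  obtain ⟨M, hM⟩ := hc.bounded_above_of_compact_support hs
  exact ⟨M, hM⟩

/-- A cutoff supported in `[1/n, 2n]` and equal to `1` on `[2/n, n]`. -/
noncomputable def cutoff (n : ℝ) (x : ℝ) : ℝ := step (n * x) * (1 - step (n⁻¹ * x))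

theorem contDiff_cutoff (n : ℝ) : ContDiff ℝ (⊤ : ℕ∞) (cutoff n) :=
  (contDiff_step.comp (contDiff_const.mul contDiff_id)).mul
    (contDiff_const.sub (contDiff_step.comp (contDiff_const.mul contDiff_id)))

theorem tsupport_cutoff_subset {n : ℝ} (hn : 0 < n) : tsupport (cutoff n) ⊆ Icc n⁻¹ (2 * n) := by
  refine closure_minimal (fun x hx => ?_) isClosed_Icc
  by_contra h
  apply hx
  rcases not_and_or.1 h with h | h
  · have : n * x ≤ 1 := by
      have := mul_le_mul_of_nonneg_left (not_le.1 h).le hn.le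
      rwa [mul_inv_cancel₀ hn.ne'] at this
    rw [cutoff, step_of_le this, zero_mul]
  · have : 2 ≤ n⁻¹ * x := by
      rw [inv_mul_eq_div, le_div_iff₀ hn]; exact (not_le.1 h).le
    rw [cutoff, step_of_ge this, sub_self, mul_zero]

theorem isTest_cutoff_mul {n : ℝ} (hn : 0 < n) {w : ℝ → ℝ} (hw : ContDiff ℝ (⊤ : ℕ∞) w) :
    IsTest fun x => cutoff n x * w x := by
  have hsub : tsupport (fun x => cutoff n x * w x) ⊆ Icc n⁻¹ (2 * n) :=
    (tsupport_mul_subset_left (f := cutoff n) (g := w)).trans (tsupport_cutoff_subset hn)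
  refine ⟨(contDiff_cutoff n).mul hw, ?_, fun x hx => (inv_pos.2 hn).trans_le (hsub hx).1⟩
  exact isCompact_Icc.of_isClosed_subset (isClosed_tsupport _) hsub

theorem cutoff_nonneg (n x : ℝ) : 0 ≤ cutoff n x :=
  mul_nonneg (step_nonneg _) (sub_nonneg.2 (step_le_one _))

theorem cutoff_le_one (n x : ℝ) : cutoff n x ≤ 1 :=
  mul_le_one₀ (step_le_one _) (sub_nonneg.2 (step_le_one _)) (by linarith [step_nonneg (n⁻¹ * x)])

theorem deriv_cutoff (n x : ℝ) : deriv (cutoff n) x =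
    n * deriv step (n * x) * (1 - step (n⁻¹ * x)) -
      step (n * x) * (n⁻¹ * deriv step (n⁻¹ * x)) := by
  have hs : Differentiable ℝ step := contDiff_step.differentiable (by simp)
  have h (c : ℝ) : HasDerivAt (fun x => step (c * x)) (c * deriv step (c * x)) x := by
    have := (hs (c * x)).hasDerivAt.comp x ((hasDerivAt_id x).const_mul c)
    exact this.congr_deriv (by ring)
  refine (((h n).mul ((h n⁻¹).const_sub 1)).congr_deriv ?_).deriv
  ring

theorem abs_mul_deriv_cutoff_le {M : ℝ} (hM : ∀ t : ℝ, |t * deriv step t| ≤ M) (n x : ℝ) :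
    |x * deriv (cutoff n) x| ≤ 2 * M := by
  have e : x * deriv (cutoff n) x = (n * x * deriv step (n * x)) * (1 - step (n⁻¹ * x)) -
      (n⁻¹ * x * deriv step (n⁻¹ * x)) * step (n * x) := by
    rw [deriv_cutoff]; ring
  have a1 : |1 - step (n⁻¹ * x)| ≤ 1 :=
    abs_le.2 ⟨by linarith [step_le_one (n⁻¹ * x)], by linarith [step_nonneg (n⁻¹ * x)]⟩
  have a2 : |step (n * x)| ≤ 1 :=
    abs_le.2 ⟨by linarith [step_nonneg (n * x)], step_le_one _⟩
  have b1 := mul_le_mul (hM (n * x)) a1 (abs_nonneg _) ((abs_nonneg _).trans (hM 0))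
  have b2 := mul_le_mul (hM (n⁻¹ * x)) a2 (abs_nonneg _) ((abs_nonneg _).trans (hM 0))
  rw [← abs_mul] at b1 b2
  rw [e]
  exact (abs_sub _ _).trans (by linarith)

theorem eventually_cutoff_eq_one {x : ℝ} (hx : 0 < x) :
    ∀ᶠ n : ℕ in atTop, cutoff ((n : ℝ) + 1) x = 1 ∧ deriv (cutoff ((n : ℝ) + 1)) x = 0 := by
  obtain ⟨k, hk⟩ := exists_nat_gt (max (2 / x) x)
  filter_upwards [eventually_ge_atTop k] with n hn
  have hkn : (k : ℝ) ≤ n := by exact_mod_cast hn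
  have h1 : 2 / x < (n : ℝ) + 1 := by linarith [(le_max_left (2 / x) x).trans_lt hk]
  have h2 : x < (n : ℝ) + 1 := by linarith [(le_max_right (2 / x) x).trans_lt hk]
  have h0 : (0 : ℝ) < (n : ℝ) + 1 := by positivity
  have h3 : 2 < ((n : ℝ) + 1) * x := (div_lt_iff₀ hx).1 h1
  have h4 : ((n : ℝ) + 1)⁻¹ * x < 1 := by rw [inv_mul_eq_div, div_lt_one h0]; exact h2
  constructor
  · rw [cutoff, step_of_ge h3.le, step_of_le h4.le]; norm_num
  · rw [deriv_cutoff, deriv_step_of_gt h3, deriv_step_of_lt h4]; ring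

/-! ### The discrete space inside `H¹₀`. -/

theorem mem_closure_of_mem_galerkinSpace {β : ℝ} (hβ : 0 < β) {N : ℕ} {U : L2Pair}
    (hU : U ∈ galerkinSpace β N) : U ∈ testSubmodule.topologicalClosure := by
  obtain ⟨p, -, h0, h1, h2⟩ := hU
  -- Vanishing at `0` supplies a factor `x`, which absorbs the growth of the cutoff's derivative
  -- there.
  obtain ⟨q, rfl⟩ : X ∣ p := by
    rw [X_dvd_iff, coeff_zero_eq_eval_zero]
    simpa [expPoly] using h0
  set w := expPoly β (X * q) with hw
  obtain ⟨M, hM⟩ := exists_abs_mul_deriv_step_le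
  have hcw : ContDiff ℝ (⊤ : ℕ∞) w := contDiff_expPoly β _
  have ht (n : ℕ) : IsTest fun x => cutoff ((n : ℝ) + 1) x * w x :=
    isTest_cutoff_mul (by positivity) hcw
  have hwL : MemLp w 2 muPos := memLp_expPoly hβ _
  have hwL' : MemLp (deriv w) 2 muPos := by rw [hw, deriv_expPoly]; exact memLp_expPoly hβ _
  have hder (n : ℕ) (x : ℝ) : deriv (fun x => cutoff ((n : ℝ) + 1) x * w x) x =
      deriv (cutoff ((n : ℝ) + 1)) x * w x + cutoff ((n : ℝ) + 1) x * deriv w x :=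
    deriv_mul ((contDiff_cutoff _).differentiable (by simp) x) (hcw.differentiable (by simp) x)
  have hsub (n x y : ℝ) : |cutoff n x * y - y| ≤ |y| := by
    have : cutoff n x * y - y = -((1 - cutoff n x) * y) := by ring
    rw [this, abs_neg, abs_mul]
    refine mul_le_of_le_one_left (abs_nonneg _) (abs_le.2 ⟨?_, ?_⟩)
    · linarith [cutoff_le_one n x]
    · linarith [cutoff_nonneg n x]
  have t1 : Tendsto (fun n => (ht n).memLp.toLp _) atTop (𝓝 (hwL.toLp w)) := by
    refine tendsto_toLp_of_dominated _ _ hwL.abs (fun n => ae_of_all _ fun x => hsub _ _ _) ?_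
    filter_upwards [ae_restrict_mem measurableSet_Ioi] with x hx
    refine tendsto_const_nhds.congr' ?_
    filter_upwards [eventually_cutoff_eq_one hx] with n hn
    rw [hn.1, one_mul]
  have t2 : Tendsto (fun n => (ht n).memLp_deriv.toLp _) atTop (𝓝 (hwL'.toLp (deriv w))) := by
    refine tendsto_toLp_of_dominated _ _
      -- The term `cutoff' * w` is `(x * cutoff') * expPoly β q`, at most `2 * M * |expPoly β q|`;
      -- the other term is at most `|w'|`.
      (((memLp_expPoly hβ q).abs.const_mul (2 * M)).add hwL'.abs) (fun n => ?_) ?_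
    · refine ae_of_all _ fun x => ?_
      have hx : deriv (fun x => cutoff ((n : ℝ) + 1) x * w x) x - deriv w x =
          x * deriv (cutoff ((n : ℝ) + 1)) x * expPoly β q x +
            (cutoff ((n : ℝ) + 1) x * deriv w x - deriv w x) := by
        rw [hder]
        simp only [hw, expPoly, eval_mul, eval_X]
        ring
      rw [hx]
      refine (abs_add_le _ _).trans (add_le_add ?_ (hsub _ _ _))
      rw [abs_mul]
      exact mul_le_mul_of_nonneg_right (abs_mul_deriv_cutoff_le hM _ _) (abs_nonneg _)
    · filter_upwards [ae_restrict_mem measurableSet_Ioi] with x hx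
      refine tendsto_const_nhds.congr' ?_
      filter_upwards [eventually_cutoff_eq_one hx] with n hn
      rw [hder, hn.1, hn.2, one_mul, zero_mul, zero_add]
  have hUeq : U = WithLp.toLp 2 (hwL.toLp w, hwL'.toLp (deriv w)) := by
    refine WithLp.ofLp_injective 2 (Prod.ext ?_ ?_)
    · exact Lp.ext (h1.trans hwL.coeFn_toLp.symm)
    · exact Lp.ext (h2.trans hwL'.coeFn_toLp.symm)
  have tU := ((WithLp.prod_continuous_toLp 2 L2 L2).tendsto _).comp (t1.prodMk_nhds t2)
  rw [hUeq]
  exact mem_closure_of_tendsto tU (Eventually.of_forall fun n =>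
    ⟨_, ht n, (ht n).memLp.coeFn_toLp, (ht n).memLp_deriv.coeFn_toLp⟩)

theorem galerkinSpace_subset_H10 {β : ℝ} (hβ : 0 < β) (N : ℕ) : galerkinSpace β N ⊆ H10 := by
  intro U hU
  refine ⟨?_, mem_closure_of_mem_galerkinSpace hβ hU⟩
  obtain ⟨p, -, -, h1, h2⟩ := hU
  intro φ hφ
  have e1 : ∫ x in Ioi (0 : ℝ), U.fst x * deriv φ x =
      ∫ x in Ioi (0 : ℝ), expPoly β p x * deriv φ x := by
    refine integral_congr_ae ?_
    filter_upwards [h1] with x hx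
    rw [hx]
  have e2 : ∫ x in Ioi (0 : ℝ), U.snd x * φ x =
      ∫ x in Ioi (0 : ℝ), deriv (expPoly β p) x * φ x := by
    refine integral_congr_ae ?_
    filter_upwards [h2] with x hx
    rw [hx]
  rw [e1, e2]
  exact hφ.integral_mul_deriv (contDiff_expPoly β p)

theorem sub_mem_galerkinSpace {β : ℝ} {N : ℕ} {U V : L2Pair} (hU : U ∈ galerkinSpace β N)
    (hV : V ∈ galerkinSpace β N) : U - V ∈ galerkinSpace β N := by
  obtain ⟨p, hp, h0, h1, h2⟩ := hU
  obtain ⟨q, hq, k0, k1, k2⟩ := hV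
  have hpq (a b : ℝ[X]) : expPoly β (a - b) = expPoly β a - expPoly β b := by
    funext x; simp [expPoly, mul_sub]
  refine ⟨p - q, Submodule.sub_mem _ hp hq, ?_, ?_, ?_⟩
  · rw [hpq, Pi.sub_apply, h0, k0, sub_zero]
  · rw [hpq]
    exact (Lp.coeFn_sub _ _).trans (h1.sub k1)
  · have : deriv (expPoly β (p - q)) = deriv (expPoly β p) - deriv (expPoly β q) := by
      simp only [deriv_expPoly, ← hpq]
      congr 1
      rw [derivative_sub]; ring
    rw [this]
    exact (Lp.coeFn_sub _ _).trans (h2.sub k2)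

/-! ### Approximation by the discrete space. -/

/-- A polynomial has a primitive vanishing at `0`, of degree at most one more. -/
theorem exists_primitive {n : ℕ} {q : ℝ[X]} (hq : q ∈ degreeLE ℝ n) :
    ∃ P ∈ degreeLE ℝ (n + 1 : ℕ), derivative P = q ∧ P.eval 0 = 0 := by
  have hn : q.natDegree ≤ n := natDegree_le_of_degree_le (mem_degreeLE.1 hq)
  refine ⟨∑ i ∈ Finset.range (n + 1), C (q.coeff i / (i + 1)) * X ^ (i + 1), ?_, ?_, ?_⟩
  · refine Submodule.sum_mem _ fun i hi => mem_degreeLE.2 ?_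
    refine (degree_C_mul_X_pow_le _ _).trans ?_
    have := Finset.mem_range.1 hi
    exact_mod_cast (by omega : i + 1 ≤ n + 1)
  · conv_rhs => rw [q.as_sum_range_C_mul_X_pow' (Nat.lt_succ_of_le hn)]
    rw [derivative_sum]
    refine Finset.sum_congr rfl fun i _ => ?_
    rw [derivative_C_mul_X_pow]
    have : ((i : ℝ) + 1) ≠ 0 := by positivity
    push_cast
    rw [div_mul_cancel₀ _ this]
  · simp [eval_finsetSum]

/-- The discrete function `w` with `w' + (β/2) w` a given scaled Laguerre function. -/
theorem exists_galerkin_primitive {β : ℝ} (hβ : 0 < β) {N : ℕ} (hN : 1 ≤ N) {g : L2}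
    (hg : g ∈ lagSpace hβ (N - 1)) :
    ∃ W ∈ galerkinSpace β N, W.snd + (β / 2) • W.fst = g := by
  obtain ⟨q, hq, rfl⟩ := hg
  obtain ⟨P, hP, hPq, hP0⟩ := exists_primitive hq
  -- Integration raises the degree from `N - 1` to `N`; this is where `1 ≤ N` enters.
  rw [Nat.sub_add_cancel hN] at hP
  refine ⟨WithLp.toLp 2 (expPolyL2 hβ P, expPolyL2 hβ (derivative P - C (β / 2) * P)),
    ⟨P, hP, by simp [expPoly, hP0], (memLp_expPoly hβ _).coeFn_toLp, ?_⟩, ?_⟩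
  · rw [deriv_expPoly]
    exact (memLp_expPoly hβ _).coeFn_toLp
  · show expPolyL2 hβ _ + (β / 2) • expPolyL2 hβ P = _
    rw [← map_smul, ← map_add, hPq, smul_eq_C_mul, sub_add_cancel]

/-- The `H¹` norm is controlled by `‖u' + (β/2) u‖` on `H¹₀(ℝ₊)`. -/
theorem norm_le_of_mem_closure {β : ℝ} (hβ : 0 < β) {U : L2Pair}
    (hU : U ∈ testSubmodule.topologicalClosure) :
    ‖U‖ ≤ (1 + 2 / β) * ‖U.snd + (β / 2) • U.fst‖ := by
  set G := ‖U.snd + (β / 2) • U.fst‖ with hG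
  have hsq : G ^ 2 = ‖U.snd‖ ^ 2 + (β / 2 * ‖U.fst‖) ^ 2 := by
    rw [hG, norm_add_sq_real, inner_smul_right, real_inner_comm, inner_fst_snd_eq_zero hU,
      norm_smul, Real.norm_of_nonneg (by positivity)]
    ring
  have hG0 : 0 ≤ G := norm_nonneg _
  have h1 : ‖U.snd‖ ≤ G :=
    abs_le_of_sq_le_sq' (by rw [hsq]; linarith [sq_nonneg (β / 2 * ‖U.fst‖)]) hG0 |>.2
  have h2 : β / 2 * ‖U.fst‖ ≤ G :=
    abs_le_of_sq_le_sq' (by rw [hsq]; linarith [sq_nonneg ‖U.snd‖]) hG0 |>.2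
  have h3 : ‖U.fst‖ ≤ 2 / β * G := by
    rw [div_mul_eq_mul_div, le_div_iff₀ hβ]; linarith
  have h4 : ‖U‖ ≤ ‖U.fst‖ + ‖U.snd‖ := by
    refine abs_le_of_sq_le_sq' ?_ (by positivity) |>.2
    rw [WithLp.prod_norm_sq_eq_of_L2]
    linarith [mul_nonneg (norm_nonneg U.fst) (norm_nonneg U.snd), add_sq ‖U.fst‖ ‖U.snd‖]
  linarith

/-- Approximation of `H¹₀(ℝ₊)` by the discrete space, in the `H¹` norm. -/
theorem exists_galerkin_approx {β : ℝ} (hβ : 0 < β) {N : ℕ} (hN : 1 ≤ N) {U : L2Pair}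
    (hU : U ∈ H10) :
    ∃ W ∈ galerkinSpace β N, ‖U - W‖ ≤
      2 * ((1 / β + 1) * ‖U.snd - lagProj hβ (N - 1) U.snd‖
        + (1 + β) * ‖U.fst - lagProj hβ (N - 1) U.fst‖) := by
  set A := U.snd - lagProj hβ (N - 1) U.snd with hA
  set B := U.fst - lagProj hβ (N - 1) U.fst with hB
  have hg : lagProj hβ (N - 1) (U.snd + (β / 2) • U.fst) ∈ lagSpace hβ (N - 1) :=
    Submodule.starProjection_apply_mem _ _
  obtain ⟨W, hW, hWg⟩ := exists_galerkin_primitive hβ hN hg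
  refine ⟨W, hW, ?_⟩
  have hmem : U - W ∈ testSubmodule.topologicalClosure :=
    Submodule.sub_mem _ hU.2 (mem_closure_of_mem_galerkinSpace hβ hW)
  -- By the choice of `W`, the operator applied to `U - W` leaves exactly the projection error of
  -- `u' + (β/2) u`.
  have hres : (U - W).snd + (β / 2) • (U - W).fst = A + (β / 2) • B := by
    rw [WithLp.sub_snd, WithLp.sub_fst, hA, hB]
    rw [map_add, map_smul] at hWg
    have : U.snd - W.snd + (β / 2) • (U.fst - W.fst) =
        U.snd + (β / 2) • U.fst - (W.snd + (β / 2) • W.fst) := by module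
    rw [this, hWg]
    module
  have hb : ‖A + (β / 2) • B‖ ≤ ‖A‖ + β / 2 * ‖B‖ := by
    refine (norm_add_le _ _).trans_eq ?_
    rw [norm_smul, Real.norm_of_nonneg (by positivity)]
  have h := norm_le_of_mem_closure hβ hmem
  rw [hres] at h
  have h' : (1 + 2 / β) * ‖A + (β / 2) • B‖ ≤ (1 + 2 / β) * (‖A‖ + β / 2 * ‖B‖) :=
    mul_le_mul_of_nonneg_left hb (by positivity)
  have e : (1 + 2 / β) * (‖A‖ + β / 2 * ‖B‖) =
      (1 + 2 * (1 / β)) * ‖A‖ + (β / 2 + 1) * ‖B‖ := by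
    field_simp
  -- The factor `2` suffices since `1 + 2/β ≤ 2 (1/β + 1)` and `β/2 + 1 ≤ 2 (1 + β)`.
  nlinarith [norm_nonneg A, norm_nonneg B, mul_nonneg hβ.le (norm_nonneg B)]

/-! ### The bilinear form and the error estimate. -/

theorem bilin_sub_left (γ : ℝ) (U V W : L2Pair) :
    bilin γ (U - V) W = bilin γ U W - bilin γ V W := by
  simp only [bilin, WithLp.sub_fst, WithLp.sub_snd, inner_sub_left]
  ring

theorem bilin_le {γ : ℝ} (hγ : 0 < γ) (U V : L2Pair) :
    bilin γ U V ≤ (1 + γ) * (‖U‖ * ‖V‖) := by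
  have h1 : inner ℝ U.snd V.snd ≤ ‖U‖ * ‖V‖ := (real_inner_le_norm _ _).trans
    (mul_le_mul (WithLp.norm_snd_le _ U) (WithLp.norm_snd_le _ V) (norm_nonneg _) (norm_nonneg _))
  have h2 : inner ℝ U.fst V.fst ≤ ‖U‖ * ‖V‖ := (real_inner_le_norm _ _).trans
    (mul_le_mul (WithLp.norm_fst_le _ U) (WithLp.norm_fst_le _ V) (norm_nonneg _) (norm_nonneg _))
  have := mul_le_mul_of_nonneg_left h2 hγ.le
  rw [bilin]
  linarith

theorem bilin_coercive (γ : ℝ) (U : L2Pair) : min 1 γ * ‖U‖ ^ 2 ≤ bilin γ U U := by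
  rw [bilin, real_inner_self_eq_norm_sq, real_inner_self_eq_norm_sq,
    WithLp.prod_norm_sq_eq_of_L2]
  have h1 := mul_le_mul_of_nonneg_right (min_le_left 1 γ) (sq_nonneg ‖U.snd‖)
  have h2 := mul_le_mul_of_nonneg_right (min_le_right 1 γ) (sq_nonneg ‖U.fst‖)
  linarith

theorem integral_sub_integral_le {f g : ℝ → ℝ} (hf : MemLp f 2 muPos) (hg : MemLp g 2 muPos)
    (v : L2) : (∫ x in Ioi (0 : ℝ), g x * v x) - ∫ x in Ioi (0 : ℝ), f x * v x ≤
      normL2 (fun x => f x - g x) * ‖v‖ := by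
  have hfg : MemLp (fun x => f x - g x) 2 muPos := hf.sub hg
  have hv : MemLp v 2 muPos := Lp.memLp v
  have e : (∫ x in Ioi (0 : ℝ), g x * v x) - ∫ x in Ioi (0 : ℝ), f x * v x =
      -inner ℝ (hfg.toLp _) v := by
    rw [inner_eq_setIntegral hfg.coeFn_toLp (ae_eq_refl v),
      ← integral_sub (f := fun x => g x * v x) (g := fun x => f x * v x)
        (hg.integrable_mul hv) (hf.integrable_mul hv), ← integral_neg]
    refine integral_congr_ae (ae_of_all _ fun x => ?_)
    ring
  rw [e]
  refine (neg_le_abs _).trans ((abs_real_inner_le_norm _ _).trans_eq ?_)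
  rw [Lp.norm_toLp]
  rfl

end LaguerreGalerkin

theorem theorem5p8 (γ : ℝ) (hγ : 0 < γ) :
    ∃ C : ℝ, 0 < C ∧
      ∀ (Z : Rule) (β : ℝ) (hβ : 0 < β) (N : ℕ), 1 ≤ N →
      ∀ f : ℝ → ℝ, ContinuousOn f (Set.Ici 0) → MeasureTheory.MemLp f 2 muPos →
      ∀ U : L2Pair, IsWeakSolution γ f U →
      ∀ UN : L2Pair, IsGalerkinSolution Z γ β N f UN →
        ‖U - UN‖ ≤ C * ((1 / β + 1) * ‖U.snd - lagProj hβ (N - 1) U.snd‖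
          + (1 + β) * ‖U.fst - lagProj hβ (N - 1) U.fst‖
          + normL2 (fun x => f x - interp Z β N f x)) := by
  set c := min 1 γ with hc
  have hc0 : 0 < c := lt_min one_pos hγ
  refine ⟨2 * (1 + (1 + γ) / c) + 1 / c, by positivity, ?_⟩
  intro Z β hβ N hN f _ hf U hU UN hUN
  obtain ⟨W, hW, hUW⟩ := exists_galerkin_approx hβ hN hU.1
  set R := (1 / β + 1) * ‖U.snd - lagProj hβ (N - 1) U.snd‖
    + (1 + β) * ‖U.fst - lagProj hβ (N - 1) U.fst‖ with hR
  set D := normL2 (fun x => f x - interp Z β N f x) with hD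
  have hR0 : 0 ≤ R := by positivity
  have hD0 : 0 ≤ D := ENNReal.toReal_nonneg
  set E := UN - W with hE
  have hEG : E ∈ galerkinSpace β N := sub_mem_galerkinSpace hUN.1 hW
  -- Since `E` is an admissible test function in both problems, `a(E, E) = (I f - f, E) + a(U - W,
  -- E)`, where `I f` is the interpolant.
  have hcons : bilin γ E E ≤ D * ‖E‖ + (1 + γ) * (‖U - W‖ * ‖E‖) := by
    have h1 := hUN.2 E hEG
    have h2 := hU.2 E (galerkinSpace_subset_H10 hβ N hEG)
    have hI : MemLp (interp Z β N f) 2 muPos := memLp_expPoly hβ _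
    have h3 := integral_sub_integral_le hf hI E.fst
    have h4 := bilin_le hγ (U - W) E
    have h5 : D * ‖E.fst‖ ≤ D * ‖E‖ := mul_le_mul_of_nonneg_left (WithLp.norm_fst_le _ E) hD0
    rw [bilin_sub_left] at h4
    have h6 : bilin γ E E = bilin γ UN E - bilin γ W E := bilin_sub_left γ UN W E
    linarith
  have hEc : c * ‖E‖ ≤ D + (1 + γ) * ‖U - W‖ := by
    -- One factor `‖E‖` is cancelled, so `‖E‖ = 0` is treated apart.
    rcases (norm_nonneg E).eq_or_lt with h | h
    · rw [← h, mul_zero]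
      positivity
    · refine le_of_mul_le_mul_right ?_ h
      linarith [bilin_coercive γ E]
  have hEb : ‖E‖ ≤ (D + (1 + γ) * ‖U - W‖) / c := (le_div_iff₀' hc0).2 hEc
  have htri : ‖U - UN‖ ≤ ‖U - W‖ + ‖E‖ := by
    have : U - UN = (U - W) - E := by rw [hE]; abel
    rw [this]
    exact norm_sub_le _ _
  calc ‖U - UN‖ ≤ ‖U - W‖ + (D + (1 + γ) * ‖U - W‖) / c := htri.trans (by gcongr)
    _ = (1 + (1 + γ) / c) * ‖U - W‖ + 1 / c * D := by ring
    _ ≤ (1 + (1 + γ) / c) * (2 * R) + 1 / c * D := by gcongr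
    _ ≤ (2 * (1 + (1 + γ) / c) + 1 / c) * (R + D) := by
      have h1 : 0 ≤ (1 + (1 + γ) / c) * D := by positivity
      have h2 : 0 ≤ 1 / c * R := by positivity
      linarith
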